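/- Let $m,n\ge 1$ be integers, $[n]=\{1,\dots,n\}$, and let $\mathbb N$ denote the set of positive integers. The $n$-dimensional $m$-Catalan arrangement is the set of hyperplanes of $\mathbb R^n$ with equations $x_i-x_j=a$, where $1\le i<j\le n$ and $a\in\{-m,-m+1,\dots,m\}$. Its regions are the connected components of the complement of the union of these hyperplanes. Let $R_0$ be the region $x_1>x_2>\dots>x_n>x_1-1$. The Pak–Stanley labeling is the map $\lambda$ from the set of regions to $\mathbb N^n$ determined by the following two rules. (i) $\lambda(R_0)=(1,\dots,1)$. (ii) If two regions $R_1,R_2$ are separated by a unique hyperplane $H$ of the arrangement, and $R_0$ and $R_1$ lie on the same side of $H$, where $H$ has equation $x_i-x_j=a$ with $i<j$, then $\lambda(R_2)=\lambda(R_1)+e_j$ if $a>0$, and $\lambda(R_2)=\lambda(R_1)+e_i$ if $a\le 0$, where $e_k$ is the $k$-th standard unit vector. For $\mathbf a=(a_1,\dots,a_n)\in\mathbb N^n$ and an integer $p\ge 0$, let $Z_p(\mathbf a)$ be the largest subset $X=\{x_1>x_2>\dots>x_q\}$ of $[n]$ such that $a_{x_j}\le p+j$ for every $j\in[q]$ (there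 is one such subset that contains all the others), and let $z_p(\mathbf a)=|Z_p(\mathbf a)|$. An $m$-Catalan function of dimension $n$ is a vector $\mathbf a\in\mathbb N^n$ such that $z_{(i-1)m}(\mathbf a)\ge i$ for every $i\in[n]$. **Theorem.** For all integers $m,n\ge 1$, the rules (i) and (ii) determine exactly one labeling $\lambda$ of the regions of the $n$-dimensional $m$-Catalan arrangement. The set of its labels is exactly the set of $m$-Catalan functions of dimension $n$, and $\lambda$ is a bijection from the set of regions onto the set of $m$-Catalan functions of dimension $n$. -/

import Mathlib

open Finset

/-- A hyperplane `x i - x j = a` (`i < j`, `a ∈ ℤ ∩ [-m, m]`) of the `n`-dimensional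
`m`-Catalan arrangement. Distinct triples `(i, j, a)` give distinct hyperplanes. -/
@[ext]
structure CatalanHyperplane (m n : ℕ) where
  i : Fin n
  j : Fin n
  a : ℤ
  lt : i < j
  neg_le : -(m : ℤ) ≤ a
  le : a ≤ (m : ℤ)

namespace CatalanHyperplane

variable {m n : ℕ}

/-- The hyperplane as a set of points. -/
def carrier (H : CatalanHyperplane m n) : Set (Fin n → ℝ) :=
  {x | x H.i - x H.j = (H.a : ℝ)}

/-- The open side `x i - x j < a`. -/
def below (H : CatalanHyperplane m n) : Set (Fin n → ℝ) :=
  {x | x H.i - x H.j < (H.a : ℝ)}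

/-- The open side `x i - x j > a`. -/
def above (H : CatalanHyperplane m n) : Set (Fin n → ℝ) :=
  {x | (H.a : ℝ) < x H.i - x H.j}

/-- `R` and `S` lie on (strictly) opposite sides of `H`. -/
def Separates (H : CatalanHyperplane m n) (R S : Set (Fin n → ℝ)) : Prop :=
  (R ⊆ H.below ∧ S ⊆ H.above) ∨ (R ⊆ H.above ∧ S ⊆ H.below)

/-- `R` and `S` lie on the same open side of `H`. -/
def SameSide (H : CatalanHyperplane m n) (R S : Set (Fin n → ℝ)) : Prop :=
  (R ⊆ H.below ∧ S ⊆ H.below) ∨ (R ⊆ H.above ∧ S ⊆ H.above)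

/-- The coordinate of the label that grows when `H` is crossed away from the base region:
for `x i - x j = a` with `i < j` it is `j` if `a > 0` and `i` if `a ≤ 0`. -/
def bumpedCoord (H : CatalanHyperplane m n) : Fin n :=
  if 0 < H.a then H.j else H.i

end CatalanHyperplane

/-- The complement of the union of the hyperplanes of the arrangement. -/
def catalanComplement (m n : ℕ) : Set (Fin n → ℝ) :=
  (⋃ H : CatalanHyperplane m n, H.carrier)ᶜ

/-- The regions of the arrangement: the connected components of the complement. -/
def catalanRegions (m n : ℕ) : Set (Set (Fin n → ℝ)) :=
  {R | ∃ x ∈ catalanComplement m n, R = connectedComponentIn (catalanComplement m n) x}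

/-- The base region `x 1 > x 2 > ⋯ > x n > x 1 - 1`. -/
def baseRegion (n : ℕ) : Set (Fin n → ℝ) :=
  {x | StrictAnti x ∧ ∀ i j, x i - x j < 1}

/-- `lab` is a Pak–Stanley labeling of the regions: the base region has label `(1, …, 1)`, and if
`H` is the only hyperplane that separates the regions `R₁` and `R₂`, with the base region on the
same side of `H` as `R₁`, then the label of `R₂` is that of `R₁` with one coordinate, determined
by `H`, increased by `1`. -/
structure IsPakStanleyLabeling (m n : ℕ) (lab : catalanRegions m n → (Fin n → ℕ)) : Prop where
  base : ∀ R : catalanRegions m n, (R : Set (Fin n → ℝ)) = baseRegion n → lab R = fun _ => 1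
  step : ∀ (R₁ R₂ : catalanRegions m n) (H : CatalanHyperplane m n),
    H.Separates R₁ R₂ →
    (∀ H' : CatalanHyperplane m n, H'.Separates R₁ R₂ → H' = H) →
    H.SameSide (baseRegion n) R₁ →
    lab R₂ = lab R₁ + Pi.single H.bumpedCoord 1

/-- `X = {x_1 > x_2 > ⋯ > x_q}` satisfies `a (x_j) ≤ p + j` for every `j`; the index `j` of an
element `x` of `X` is the number of elements of `X` that are at least `x`. -/
def IsCentral {n : ℕ} (a : Fin n → ℕ) (p : ℕ) (X : Finset (Fin n)) : Prop :=
  ∀ x ∈ X, a x ≤ p + #{y ∈ X | x ≤ y}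

open Classical in
/-- The `p`-center of `a`: the largest set `X` with `IsCentral a p X`
(see `isGreatest_centerSet`). -/
noncomputable def centerSet {n : ℕ} (a : Fin n → ℕ) (p : ℕ) : Finset (Fin n) :=
  {x | ∃ X, IsCentral a p X ∧ x ∈ X}

theorem isGreatest_centerSet {n : ℕ} (a : Fin n → ℕ) (p : ℕ) :
    IsGreatest {X | IsCentral a p X} (centerSet a p) := by
  have hsub : ∀ X, IsCentral a p X → X ⊆ centerSet a p := by
    intro X hX x hx
    simp only [centerSet, Finset.mem_filter, Finset.mem_univ, true_and]
    exact ⟨X, hX, hx⟩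
  refine ⟨?_, fun X hX => hsub X hX⟩
  intro x hx
  simp only [centerSet, Finset.mem_filter, Finset.mem_univ, true_and] at hx
  obtain ⟨X, hX, hxX⟩ := hx
  refine (hX x hxX).trans ?_
  have := Finset.card_le_card (Finset.filter_subset_filter (fun y => x ≤ y) (hsub X hX))
  omega

/-- `z_p(a)`, the number of elements of the `p`-center of `a`. -/
noncomputable def centerCard {n : ℕ} (a : Fin n → ℕ) (p : ℕ) : ℕ := #(centerSet a p)

/-- The `m`-Catalan functions of dimension `n`: vectors of positive integers with
`z_{(i - 1) m}(a) ≥ i` for `i = 1, …, n` (below `i` runs over `0, …, n - 1`). -/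
def catalanFunctions (m n : ℕ) : Set (Fin n → ℕ) :=
  {a | (∀ i, 1 ≤ a i) ∧ ∀ i : Fin n, (i : ℕ) + 1 ≤ centerCard a ((i : ℕ) * m)}

/-! The labeling has a closed form. Crossing a hyperplane away from the base region makes some `x k`
fall below a translate `x i - t` with `0 ≤ t ≤ m` (for `t = 0` only if `k < i`), and `k` is the
bumped coordinate. So the label at `k` is `1` plus a shift count (pairs with `t ≥ 1`) plus a Lehmer
code entry (pairs with `t = 0`), as in `pointLabel_eq_ncard`. This function of the region obeys both
rules. It is the only one that does, because every region is reached from the base region by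
crossing one hyperplane at a time (`exists_farSide_ssubset_ssubset`).

The centers decode the label: the `p`-center of a label is the set of indices with shift count at
most `p` (`centerSet_pointLabel`). Hence the label determines the shift counts, then the Lehmer
code, then the order of the coordinates, and finally the position of each `x k` among the translates
of the larger coordinates. This gives injectivity (`lt_sub_iff_of_pointLabel_eq`).

For surjectivity, let `c k` be the least `p` whose center contains `k`. Maximality of the centers
bounds `a k - c k - 1` so that it is the Lehmer code of an order in which `c` increases as the
values decrease. The Catalan condition says that `c k` is at most `m` times the number of larger
values, which is what is needed to place the coordinates one by one, from the largest down
(`exists_pointLabel_eq`). -/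

section Gaps

/-! ### Positions of a real number relative to a finite set. -/

theorem exists_lt_forall_lt_of_lt (T : Finset ℝ) (v : ℝ) : ∃ u < v, ∀ s ∈ T, s < v → s < u := by
  have h : ∀ᶠ u in nhdsWithin v (Set.Iio v), u < v ∧ ∀ s ∈ T, s < v → s < u := by
    refine (eventually_mem_nhdsWithin).and ((Filter.eventually_all_finset T).2 fun s _ => ?_)
    by_cases hs : s < v
    · filter_upwards [Ioo_mem_nhdsLT hs] with u hu _ using hu.1
    · exact Filter.Eventually.of_forall fun u h => absurd h hs
  obtain ⟨u, h1, h2⟩ := h.exists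
  exact ⟨u, h1, h2⟩

/-- Below a point outside a finite set `S` there is a point, outside any given finite set, with a
prescribed number of elements of `S` above it. -/
theorem exists_lt_card_filter_lt_eq (S F : Finset ℝ) (v : ℝ) (hv : v ∉ S) (r : ℕ)
    (hle : #{s ∈ S | v < s} ≤ r) (hr : r ≤ #S) :
    ∃ u < v, u ∉ F ∧ #{s ∈ S | u < s} = r := by
  obtain ⟨d, rfl⟩ := Nat.exists_eq_add_of_le hle
  clear hle
  induction d generalizing v with
  | zero =>
    obtain ⟨u, huv, hu⟩ := exists_lt_forall_lt_of_lt (S ∪ F) v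
    refine ⟨u, huv, fun h => (hu u (mem_union_right _ h) huv).false, ?_⟩
    rw [add_zero]
    congr 1
    refine filter_congr fun s hs => ⟨fun h => ?_, huv.trans⟩
    by_contra h'
    have hne : s ≠ v := fun h => hv (h ▸ hs)
    exact (hu s (mem_union_left _ hs) (lt_of_le_of_ne (not_lt.1 h') hne)).not_gt h
  | succ d ih =>
    have hne : ({s ∈ S | s < v}).Nonempty := by
      by_contra h
      rw [not_nonempty_iff_eq_empty, filter_eq_empty_iff] at h
      have : {s ∈ S | v < s} = S := filter_eq_self.2 fun s hs =>
        lt_of_le_of_ne (not_lt.1 (h hs)) fun h => hv (h ▸ hs)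
      rw [this] at hr
      omega
    -- Passing just below the largest element `w` of `S` under `v` raises the count by exactly one.
    obtain ⟨w, hw, hmax⟩ := exists_max_image _ id hne
    obtain ⟨hwS, hwv⟩ := mem_filter.1 hw
    obtain ⟨u, huw, hu⟩ := exists_lt_forall_lt_of_lt S w
    have huS : u ∉ S := fun h => (hu u h huw).false
    have heq : {s ∈ S | u < s} = insert w {s ∈ S | v < s} := by
      ext s
      simp only [mem_filter, mem_insert]
      constructor
      · rintro ⟨hs, hus⟩
        rcases lt_trichotomy s v with h | h | h
        · left
          refine le_antisymm (hmax s (mem_filter.2 ⟨hs, h⟩)) ?_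
          by_contra h'
          exact (hu s hs (not_le.1 h')).not_gt hus
        · exact absurd (h ▸ hs) hv
        · exact Or.inr ⟨hs, h⟩
      · rintro (rfl | ⟨hs, h⟩)
        · exact ⟨hwS, huw⟩
        · exact ⟨hs, (huw.trans hwv).trans h⟩
    have hcard : #{s ∈ S | u < s} = #{s ∈ S | v < s} + 1 := by
      rw [heq, card_insert_of_notMem]
      simp [hwv.le]
    obtain ⟨u', hu', hF, hc⟩ := ih u huS (by omega)
    exact ⟨u', hu'.trans (huw.trans hwv), hF, by omega⟩

/-- Compatibility of `f` and `g` makes the two upper sets nested, and nested finite sets of equal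
size coincide. This is how counts are turned back into comparisons. -/
theorem filter_lt_eq_of_card_eq {ι : Type*} {A : Finset ι} {f g : ι → ℝ} {u v : ℝ}
    (h : ∀ p ∈ A, ∀ q ∈ A, f q < f p → g q ≤ g p)
    (hc : #{i ∈ A | u < f i} = #{i ∈ A | v < g i}) :
    {i ∈ A | u < f i} = {i ∈ A | v < g i} := by
  by_contra hne
  have h1 : ¬ {i ∈ A | u < f i} ⊆ {i ∈ A | v < g i} := fun hs =>
    hne (eq_of_subset_of_card_le hs hc.ge)
  have h2 : ¬ {i ∈ A | v < g i} ⊆ {i ∈ A | u < f i} := fun hs =>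
    hne (eq_of_subset_of_card_le hs hc.le).symm
  obtain ⟨p, hp, hp'⟩ := not_subset.1 h1
  obtain ⟨q, hq, hq'⟩ := not_subset.1 h2
  simp only [mem_filter, not_and, not_lt] at hp hq hp' hq'
  have := h p hp.1 q hq.1 ((hq' hq.1).trans_lt hp.2)
  linarith [hp' hp.1, hq.2]

end Gaps

/-! ### The closed form of the label, and why it determines the region. -/

section Label

variable {n : ℕ}

/-- The number of translates `x i - t`, `1 ≤ t ≤ m`, that are larger than `x k`. -/
noncomputable def shiftCount (m : ℕ) (x : Fin n → ℝ) (k : Fin n) : ℕ :=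
  #{p ∈ (univ : Finset (Fin n)) ×ˢ Icc 1 m | x k < x p.1 - (p.2 : ℝ)}

/-- The number of larger indices with larger values. -/
noncomputable def codeCount (x : Fin n → ℝ) (k : Fin n) : ℕ := #{i ∈ Ioi k | x k < x i}

/-- The Pak–Stanley label of the region that contains `x`. -/
noncomputable def pointLabel (m : ℕ) (x : Fin n → ℝ) (k : Fin n) : ℕ :=
  shiftCount m x k + codeCount x k + 1

theorem shiftCount_le_of_le (m : ℕ) {x : Fin n → ℝ} {i k : Fin n} (h : x k ≤ x i) :
    shiftCount m x i ≤ shiftCount m x k :=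
  card_le_card (monotone_filter_right _ fun _ _ hp => h.trans_lt hp)

theorem shiftCount_le (m : ℕ) (x : Fin n → ℝ) (k : Fin n) :
    shiftCount m x k ≤ #{i | x k < x i} * m := by
  have : #(({i | x k < x i} : Finset (Fin n)) ×ˢ Icc 1 m) = #{i | x k < x i} * m := by
    simp [card_product]
  rw [← this]
  refine card_le_card fun p hp => ?_
  simp only [mem_filter, mem_product, mem_univ, true_and] at hp ⊢
  have : (0 : ℝ) ≤ p.2 := Nat.cast_nonneg _
  exact ⟨by linarith, hp.1⟩

/-- The larger indices counted by the code of `k` have larger values, hence smaller or equal shift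
counts, so the set contains them and is central. Conversely, let `k` be the largest index of a
central `X` outside the set. All larger indices of `X` have smaller shift counts, hence larger
values, so the code of `k` counts them and the label of `k` is too big. -/
theorem isGreatest_shiftCount_le (m : ℕ) (x : Fin n → ℝ) (p : ℕ) :
    IsGreatest {X | IsCentral (pointLabel m x) p X} ({k | shiftCount m x k ≤ p} : Finset _) := by
  constructor
  · intro k hk
    have hk : shiftCount m x k ≤ p := by simpa using hk
    have : #(insert k {i ∈ Ioi k | x k < x i}) ≤
        #{y ∈ ({k | shiftCount m x k ≤ p} : Finset _) | k ≤ y} := by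
      refine card_le_card fun i hi => ?_
      simp only [mem_insert, mem_filter, mem_Ioi, mem_univ, true_and] at hi ⊢
      rcases hi with rfl | ⟨h1, h2⟩
      · exact ⟨hk, le_rfl⟩
      · exact ⟨(shiftCount_le_of_le m h2.le).trans hk, h1.le⟩
    rw [card_insert_of_notMem (by simp)] at this
    unfold pointLabel codeCount
    omega
  · intro X hX
    by_contra hsub
    have hne : (X \ ({k | shiftCount m x k ≤ p} : Finset _)).Nonempty := sdiff_nonempty.2 hsub
    obtain ⟨k, hk, hmax⟩ := exists_max_image _ id hne
    simp only [mem_sdiff, mem_filter, mem_univ, true_and, not_le, id] at hk hmax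
    have h1 := hX k hk.1
    have h2 : #{y ∈ X | k ≤ y} ≤ #(insert k {i ∈ Ioi k | x k < x i}) := by
      refine card_le_card fun i hi => ?_
      simp only [mem_insert, mem_filter, mem_Ioi] at hi ⊢
      rcases hi.2.eq_or_lt with h | h
      · exact Or.inl h.symm
      · refine Or.inr ⟨h, ?_⟩
        by_contra hle
        exact (hmax i ⟨hi.1, hk.2.trans_le (shiftCount_le_of_le m (not_lt.1 hle))⟩).not_gt h
    rw [card_insert_of_notMem (by simp)] at h2
    unfold pointLabel codeCount at h1
    omega

theorem centerSet_pointLabel (m : ℕ) (x : Fin n → ℝ) (p : ℕ) :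
    centerSet (pointLabel m x) p = ({k | shiftCount m x k ≤ p} : Finset _) :=
  (isGreatest_centerSet _ p).unique (isGreatest_shiftCount_le m x p)

theorem pointLabel_mem_catalanFunctions (m : ℕ) (x : Fin n → ℝ) :
    pointLabel m x ∈ catalanFunctions m n := by
  refine ⟨fun i => Nat.le_add_left _ _, fun i => ?_⟩
  rw [centerCard, centerSet_pointLabel]
  by_contra hlt
  have hne : (({k | shiftCount m x k ≤ i * m} : Finset (Fin n))ᶜ).Nonempty := by
    rw [← card_pos, card_compl, Fintype.card_fin]
    omega
  -- Everything above the highest point `k` outside the center lies in the center. So at most `i`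
  -- points are above `k`, and they have at most `i * m` translates above it.
  obtain ⟨k, hk, hmax⟩ := exists_max_image _ x hne
  simp only [mem_compl, mem_filter, mem_univ, true_and, not_le] at hk hmax
  have hsub : ({i | x k < x i} : Finset (Fin n)) ⊆
      ({k | shiftCount m x k ≤ i * m} : Finset (Fin n)) := by
    intro j hj
    simp only [mem_filter, mem_univ, true_and] at hj ⊢
    by_contra h
    exact (hmax j (not_le.1 h)).not_gt hj
  have h1 := card_le_card hsub
  have h2 := shiftCount_le m x k
  have h3 : #{i | x k < x i} * m ≤ i * m := Nat.mul_le_mul_right m (by omega)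
  omega

/-- A Lehmer code determines its permutation: by descending induction on `k`, the entry at `k` is
the rank of `f k` among the values at larger indices, whose order is already known. -/
theorem lt_iff_lt_of_codeCount_eq {f g : Fin n → ℝ} (hf : f.Injective) (hg : g.Injective)
    (h : ∀ k, codeCount f k = codeCount g k) (i j : Fin n) : f i < f j ↔ g i < g j := by
  have key : ∀ k : Fin n, ∀ i, k < i → (f k < f i ↔ g k < g i) := by
    intro k
    induction k using WellFoundedGT.induction with
    | ind k ih =>
      intro i hi
      have := filter_lt_eq_of_card_eq (A := Ioi k) (f := f) (g := g) (u := f k) (v := g k) ?_ (h k)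
      · simpa [hi] using congrArg (i ∈ ·) this
      · intro p hp q hq hlt
        rw [mem_Ioi] at hp hq
        rcases lt_trichotomy q p with hqp | rfl | hpq
        · exact ((ih q hq p hqp).1 hlt).le
        · exact le_rfl
        · exact not_lt.1 fun h' => hlt.not_gt ((ih p hp q hpq).2 h')
  rcases lt_trichotomy i j with hij | rfl | hij
  · exact key i j hij
  · simp
  · have := key j i hij
    have h1 := hf.ne hij.ne
    have h2 := hg.ne hij.ne
    constructor <;> intro h3
    · exact lt_of_le_of_ne (not_lt.1 fun h4 => h3.not_gt (this.2 h4)) h2.symm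
    · exact lt_of_le_of_ne (not_lt.1 fun h4 => h3.not_gt (this.1 h4)) h1.symm

/-- Induction from the largest value downwards: only translates of larger values can exceed `f k`,
their mutual order is known by induction, and the shift count says how many of them do. -/
theorem lt_sub_iff_of_shiftCount_eq {m : ℕ} {f g : Fin n → ℝ}
    (hfg : ∀ i j, f i < f j ↔ g i < g j) (h : ∀ k, shiftCount m f k = shiftCount m g k)
    (k i : Fin n) {t : ℕ} (ht : 1 ≤ t) (htm : t ≤ m) : f k < f i - t ↔ g k < g i - t := by
  induction hN : #{j | f k < f j} using Nat.strong_induction_on generalizing k i t with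
  | _ N ih =>
    have ih' : ∀ k', f k < f k' → ∀ i, ∀ t : ℕ, 1 ≤ t → t ≤ m →
        (f k' < f i - t ↔ g k' < g i - t) := by
      intro k' hk' i t ht htm
      refine ih _ ?_ k' i ht htm rfl
      rw [← hN]
      refine card_lt_card ⟨fun j hj => ?_, fun hs => ?_⟩
      · simp only [mem_filter, mem_univ, true_and] at hj ⊢
        exact hk'.trans hj
      · simpa using hs (show k' ∈ _ by simpa using hk')
    let A : Finset (Fin n × ℕ) := {p ∈ (univ : Finset (Fin n)) ×ˢ Icc 1 m | f k < f p.1}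
    have hA : ∀ p : Fin n × ℕ, p ∈ A ↔ (1 ≤ p.2 ∧ p.2 ≤ m) ∧ f k < f p.1 := by
      intro p
      simp [A]
    have h1 : {p ∈ A | f k < f p.1 - (p.2 : ℝ)} =
        {p ∈ (univ : Finset (Fin n)) ×ˢ Icc 1 m | f k < f p.1 - (p.2 : ℝ)} := by
      rw [filter_filter]
      refine filter_congr fun p _ => ⟨And.right, fun h => ⟨?_, h⟩⟩
      linarith [(Nat.cast_nonneg p.2 : (0 : ℝ) ≤ p.2)]
    have h2 : {p ∈ A | g k < g p.1 - (p.2 : ℝ)} =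
        {p ∈ (univ : Finset (Fin n)) ×ˢ Icc 1 m | g k < g p.1 - (p.2 : ℝ)} := by
      rw [filter_filter]
      refine filter_congr fun p _ => ⟨And.right, fun h => ⟨?_, h⟩⟩
      rw [hfg]
      linarith [(Nat.cast_nonneg p.2 : (0 : ℝ) ≤ p.2)]
    have key := filter_lt_eq_of_card_eq (A := A) (f := fun p => f p.1 - (p.2 : ℝ))
      (g := fun p => g p.1 - (p.2 : ℝ)) (u := f k) (v := g k) ?_
      (by rw [h1, h2]; exact h k)
    · rw [h1, h2] at key
      simpa [ht, htm] using congrArg ((i, t) ∈ ·) key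
    · rintro ⟨p, s⟩ hp ⟨q, t⟩ hq hlt
      rw [hA] at hp hq
      dsimp only at hp hq hlt ⊢
      -- Cancelling the smaller shift leaves a comparison with a single shift of at most `m`, based
      -- at a point above `k`.
      rcases lt_trichotomy s t with hst | rfl | hst
      · by_contra! hcon
        have := (ih' p hp.2 q (t - s) (by omega) (by omega)).2
        rw [Nat.cast_sub hst.le] at this
        linarith [this (by linarith)]
      · linarith [(hfg q p).1 (by linarith)]
      · have := (ih' q hq.2 p (s - t) (by omega) (by omega)).1
        rw [Nat.cast_sub hst.le] at this
        linarith [this (by linarith)]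

/-- The label of an injective point determines its position relative to all hyperplanes. -/
theorem lt_sub_iff_of_pointLabel_eq {m : ℕ} {f g : Fin n → ℝ} (hf : f.Injective)
    (hg : g.Injective) (h : pointLabel m f = pointLabel m g) (k i : Fin n) {t : ℕ} (htm : t ≤ m) :
    f k < f i - t ↔ g k < g i - t := by
  have hs : ∀ k, shiftCount m f k = shiftCount m g k := by
    intro k
    have h1 : ∀ p, shiftCount m f k ≤ p ↔ shiftCount m g k ≤ p := by
      intro p
      have := congrArg (k ∈ centerSet · p) h
      simpa [centerSet_pointLabel] using this
    exact le_antisymm ((h1 _).2 le_rfl) ((h1 _).1 le_rfl)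
  have hc : ∀ k, codeCount f k = codeCount g k := by
    intro k
    have h1 := congrFun h k
    have h2 := hs k
    unfold pointLabel at h1
    omega
  have hfg := lt_iff_lt_of_codeCount_eq hf hg hc
  rcases Nat.eq_zero_or_pos t with rfl | ht
  · simpa using hfg k i
  · exact lt_sub_iff_of_shiftCount_eq hfg hs k i ht htm

end Label

/-! ### Every Catalan function is the label of a point. -/

section Realization

theorem exists_lt_card_filter_lt_apply_eq {ι : Type*} {A : Finset ι} {f : ι → ℝ}
    (hf : Set.InjOn f A) (F : Finset ℝ) {v : ℝ} (hv : ∀ i ∈ A, f i ≠ v) {r : ℕ}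
    (hle : #{i ∈ A | v < f i} ≤ r) (hr : r ≤ #A) :
    ∃ u < v, u ∉ F ∧ #{i ∈ A | u < f i} = r := by
  classical
  have h : ∀ u, #{s ∈ A.image f | u < s} = #{i ∈ A | u < f i} := by
    intro u
    rw [filter_image, card_image_of_injOn]
    exact hf.mono (filter_subset _ _)
  obtain ⟨u, h1, h2, h3⟩ := exists_lt_card_filter_lt_eq (A.image f) F v
    (by simpa using hv) r (by rwa [h]) (by rwa [card_image_of_injOn hf])
  exact ⟨u, h1, h2, by rwa [h] at h3⟩

variable {n : ℕ}

/-- Lehmer codes compatible with a given level function are realized by an injective function. -/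
theorem exists_injOn_code_eq (c e : Fin n → ℕ) (s : Finset (Fin n)) :
    (∀ k ∈ s, #{i ∈ s | k < i ∧ c i < c k} ≤ e k ∧ e k ≤ #{i ∈ s | k < i ∧ c i ≤ c k}) →
    ∃ f : Fin n → ℝ, Set.InjOn f s ∧ (∀ i ∈ s, ∀ j ∈ s, c i < c j → f j < f i) ∧
      ∀ k ∈ s, #{i ∈ s | k < i ∧ f k < f i} = e k := by
  -- The smallest index enters last, so the other codes are unaffected.
  induction s using Finset.induction_on_min with
  | empty => exact fun _ => ⟨0, by simp⟩
  | insert a s ha ih =>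
    intro h
    have has : a ∉ s := fun h => (ha a h).false
    have hins : ∀ k ∈ s, ∀ P : Fin n → Prop, ∀ [DecidablePred P],
        {i ∈ insert a s | k < i ∧ P i} = {i ∈ s | k < i ∧ P i} := by
      intro k hk P _
      rw [filter_insert, if_neg fun h' => (ha k hk).not_gt h'.1]
    have hself : ∀ P : Fin n → Prop, ∀ [DecidablePred P],
        {i ∈ insert a s | a < i ∧ P i} = {i ∈ s | P i} := by
      intro P _
      rw [filter_insert, if_neg fun h' => h'.1.false]
      exact filter_congr fun i hi => by simp [ha i hi]
    obtain ⟨f, hinj, hmono, hcode⟩ := ih fun k hk => by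
      have := h k (mem_insert_of_mem hk)
      rwa [hins k hk, hins k hk] at this
    obtain ⟨h1, h2⟩ := h a (mem_insert_self a s)
    rw [hself] at h1 h2
    obtain ⟨v, hv⟩ : ∃ v, ∀ i ∈ s, f i < v := by
      obtain ⟨v, hv⟩ := (s.image f).exists_le
      exact ⟨v + 1, fun i hi => (hv _ (mem_image_of_mem f hi)).trans_lt (lt_add_one v)⟩
    obtain ⟨u, -, huF, hu⟩ := exists_lt_card_filter_lt_apply_eq (r := e a) hinj (s.image f)
      (fun i hi => (hv i hi).ne)
      (by rw [filter_eq_empty_iff.2 fun i hi => (hv i hi).not_gt]; simp)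
      (h2.trans (card_filter_le _ _))
    have hne : ∀ i ∈ s, f i ≠ u := fun i hi h => huF (h ▸ mem_image_of_mem f hi)
    have hupd : ∀ i ∈ s, Function.update f a u i = f i := fun i hi =>
      Function.update_of_ne (fun h : i = a => has (h ▸ hi)) _ _
    refine ⟨Function.update f a u, ?_, ?_, ?_⟩
    · rw [coe_insert, Set.injOn_insert (by simpa using has)]
      refine ⟨fun i hi j hj hij => ?_, ?_⟩
      · rw [hupd i hi, hupd j hj] at hij
        exact hinj hi hj hij
      · rintro ⟨i, hi, hiu⟩
        rw [hupd i hi, Function.update_self] at hiu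
        exact hne i hi hiu
    · intro i hi j hj hij
      rw [mem_insert] at hi hj
      rcases hi with rfl | hi <;> rcases hj with rfl | hj
      · exact absurd hij (lt_irrefl _)
      · rw [hupd j hj, Function.update_self]
        by_contra hlt
        -- Otherwise `j` and all indices of level at most `c i` would lie above `u`, exceeding the
        -- upper bound on `e i`.
        have : #(insert j {l ∈ s | c l ≤ c i}) ≤ #{l ∈ s | u < f l} := by
          refine card_le_card fun l hl => ?_
          simp only [mem_insert, mem_filter] at hl ⊢
          have huj := lt_of_le_of_ne (not_lt.1 hlt) (hne j hj).symm
          rcases hl with rfl | hl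
          · exact ⟨hj, huj⟩
          · exact ⟨hl.1, huj.trans (hmono l hl.1 j hj (hl.2.trans_lt hij))⟩
        rw [card_insert_of_notMem (by simp [hij])] at this
        omega
      · rw [hupd i hi, Function.update_self]
        by_contra hlt
        -- Otherwise all indices above `u`, and also `i`, would have level below `c j`, violating
        -- the lower bound on `e j`.
        have : #(insert i {l ∈ s | u < f l}) ≤ #{l ∈ s | c l < c j} := by
          refine card_le_card fun l hl => ?_
          simp only [mem_insert, mem_filter] at hl ⊢
          rcases hl with rfl | hl
          · exact ⟨hi, hij⟩
          · refine ⟨hl.1, lt_of_le_of_lt ?_ hij⟩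
            by_contra! hc
            linarith [hmono i hi l hl.1 hc]
        rw [card_insert_of_notMem (by simp [not_lt.1 hlt])] at this
        omega
      · rw [hupd i hi, hupd j hj]
        exact hmono i hi j hj hij
    · intro k hk
      rw [mem_insert] at hk
      rcases hk with rfl | hk
      · rw [hself, ← hu, Function.update_self]
        exact congrArg card (filter_congr fun i hi => by rw [hupd i hi])
      · rw [hins k hk, ← hcode k hk, hupd k hk]
        exact congrArg card (filter_congr fun i hi => by rw [hupd i hi])

/-- A monotone bounded sequence of heights is the sequence of shift counts of a point that avoids
the hyperplanes. -/
theorem exists_shift_eq (m : ℕ) (c : Fin n → ℕ) {f : Fin n → ℝ}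
    (hmono : ∀ i j, c i < c j → f j < f i) (hf : f.Injective) (s : Finset (Fin n)) :
    (∀ k ∈ s, c k ≤ #{i ∈ s | f k < f i} * m) →
    ∃ y : Fin n → ℝ, (∀ i ∈ s, ∀ j ∈ s, f i < f j → y i < y j) ∧
      (∀ i ∈ s, ∀ j ∈ s, i ≠ j → ∀ z ∈ Icc (-m : ℤ) m, y i ≠ y j + z) ∧
      ∀ k ∈ s, #{p ∈ s ×ˢ Icc 1 m | y k < y p.1 - (p.2 : ℝ)} = c k := by
  -- Points enter in decreasing order of `f`. The new point is the lowest, so its translates change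
  -- no earlier count.
  induction s using Finset.induction_on_max_value (fun i => -f i) with
  | empty => exact fun _ => ⟨0, by simp⟩
  | insert a s has ha ih =>
    intro h
    have ha : ∀ i ∈ s, f a < f i := fun i hi =>
      lt_of_le_of_ne (neg_le_neg_iff.1 (ha i hi)) (hf.ne fun h => has (h ▸ hi))
    obtain ⟨y, hy, hgen, hc⟩ := ih fun k hk => by
      have := h k (mem_insert_of_mem hk)
      rwa [filter_insert, if_neg (ha k hk).not_gt] at this
    have hca := h a (mem_insert_self a s)
    rw [filter_insert, if_neg (lt_irrefl _), filter_true_of_mem ha] at hca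
    have hinj : Set.InjOn (fun p : Fin n × ℕ => y p.1 - (p.2 : ℝ)) ↑(s ×ˢ Icc 1 m) := by
      rintro ⟨i, t⟩ hi ⟨j, r⟩ hj hij
      simp only [coe_product, Set.mem_prod, mem_coe, mem_Icc] at hi hj
      dsimp only at hij
      by_cases hne : i = j
      · subst hne
        have : (t : ℝ) = r := by linarith
        rw [Nat.cast_injective this]
      · refine absurd ?_ (hgen i hi.1 j hj.1 hne ((t : ℤ) - r) (by rw [mem_Icc]; omega))
        push_cast
        linarith
    -- The search starts at the lowest point placed so far, whose count `c b` is at most `c a` by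
    -- monotonicity.
    obtain ⟨v, hvy, hv, hvc⟩ : ∃ v, (∀ i ∈ s, v ≤ y i) ∧
        (∀ p ∈ s ×ˢ Icc 1 m, y p.1 - (p.2 : ℝ) ≠ v) ∧
        #{p ∈ s ×ˢ Icc 1 m | v < y p.1 - (p.2 : ℝ)} ≤ c a := by
      rcases s.eq_empty_or_nonempty with rfl | hs
      · exact ⟨0, by simp⟩
      · obtain ⟨b, hb, hmin⟩ := exists_min_image s y hs
        refine ⟨y b, hmin, ?_, ?_⟩
        · rintro ⟨i, t⟩ hi hib
          simp only [mem_product, mem_Icc] at hi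
          dsimp only at hib
          by_cases hne : i = b
          · subst hne
            have : (1 : ℝ) ≤ t := by exact_mod_cast hi.2.1
            linarith
          · refine hgen i hi.1 b hb hne (t : ℤ) (by rw [mem_Icc]; omega) ?_
            push_cast
            linarith
        · rw [hc b hb]
          by_contra! hlt
          exact (hmono a b hlt).not_gt (ha b hb)
    obtain ⟨u, huv, huF, hu⟩ := exists_lt_card_filter_lt_apply_eq hinj
      ((s ×ˢ Icc (-m : ℤ) m).image fun p => y p.1 + (p.2 : ℝ)) hv hvc
      (by rw [card_product, Nat.card_Icc]; simpa using hca)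
    have hne : ∀ i ∈ s, ∀ z ∈ Icc (-m : ℤ) m, u ≠ y i + z := fun i hi z hz h =>
      huF (mem_image.2 ⟨(i, z), mk_mem_product hi hz, h.symm⟩)
    have huy : ∀ i ∈ s, u < y i := fun i hi => huv.trans_le (hvy i hi)
    have hupd : ∀ i ∈ s, Function.update y a u i = y i := fun i hi =>
      Function.update_of_ne (fun h : i = a => has (h ▸ hi)) _ _
    have hprod : ∀ w, u ≤ w → #{p ∈ insert a s ×ˢ Icc 1 m |
        w < Function.update y a u p.1 - (p.2 : ℝ)} =
        #{p ∈ s ×ˢ Icc 1 m | w < y p.1 - (p.2 : ℝ)} := by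
      intro w hw
      congr 1
      ext ⟨i, t⟩
      simp only [mem_filter, mem_product, mem_insert]
      by_cases hi : i ∈ s
      · simp [hi, hupd i hi]
      · simp only [hi, or_false, false_and, iff_false]
        rintro ⟨⟨rfl, -⟩, hlt⟩
        rw [Function.update_self] at hlt
        linarith [(Nat.cast_nonneg t : (0 : ℝ) ≤ t)]
    refine ⟨Function.update y a u, ?_, ?_, ?_⟩
    · intro i hi j hj hij
      rw [mem_insert] at hi hj
      rcases hi with rfl | hi <;> rcases hj with rfl | hj
      · exact absurd hij (lt_irrefl _)
      · rw [hupd j hj, Function.update_self]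
        exact huy j hj
      · exact absurd hij (ha i hi).not_gt
      · rw [hupd i hi, hupd j hj]
        exact hy i hi j hj hij
    · intro i hi j hj hij z hz
      rw [mem_insert] at hi hj
      rcases hi with rfl | hi <;> rcases hj with rfl | hj
      · exact absurd rfl hij
      · rw [hupd j hj, Function.update_self]
        exact hne j hj z hz
      · rw [hupd i hi, Function.update_self]
        intro h
        refine hne i hi (-z) (by rw [mem_Icc] at hz ⊢; omega) ?_
        push_cast
        linarith
      · rw [hupd i hi, hupd j hj]
        exact hgen i hi j hj hij z hz
    · intro k hk
      rw [mem_insert] at hk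
      rcases hk with rfl | hk
      · rw [Function.update_self, hprod u le_rfl, hu]
      · rw [hupd k hk, hprod _ (huy k hk).le, hc k hk]

theorem centerSet_mono (a : Fin n → ℕ) : Monotone (centerSet a) := fun p q hpq =>
  (isGreatest_centerSet a q).2 fun x hx =>
    ((isGreatest_centerSet a p).1 x hx).trans (Nat.add_le_add_right hpq _)

/-- The level function of the filtration of the indices by the centers. -/
theorem exists_mem_centerSet_iff (a : Fin n → ℕ) :
    ∃ c : Fin n → ℕ, ∀ k p, k ∈ centerSet a p ↔ c k ≤ p := by
  classical
  have hex : ∀ k, ∃ p, k ∈ centerSet a p := fun k =>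
    have hk : IsCentral a (a k) {k} := fun x hx => by
      rw [mem_singleton.1 hx]
      exact Nat.le_add_right _ _
    ⟨a k, (isGreatest_centerSet a (a k)).2 hk (mem_singleton_self k)⟩
  refine ⟨fun k => Nat.find (hex k), fun k p => ⟨fun h => Nat.find_min' _ h, fun h => ?_⟩⟩
  exact centerSet_mono a h (Nat.find_spec (hex k))

theorem exists_pointLabel_eq {m : ℕ} {a : Fin n → ℕ} (ha : a ∈ catalanFunctions m n) :
    ∃ x : Fin n → ℝ, (∀ i j, i ≠ j → ∀ z ∈ Icc (-m : ℤ) m, x i ≠ x j + z) ∧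
      pointLabel m x = a := by
  obtain ⟨c, hc⟩ := exists_mem_centerSet_iff a
  have hlow : ∀ k, c k + #{i ∈ univ | k < i ∧ c i < c k} + 1 ≤ a k := by
    intro k
    rcases Nat.eq_zero_or_pos (c k) with h0 | hpos
    · have : #{i ∈ univ | k < i ∧ c i < c k} = 0 := by simp [h0]
      have := ha.1 k
      omega
    by_contra! hlt
    have hk : k ∉ centerSet a (c k - 1) := by
      rw [hc]
      omega
    -- If `a k` were smaller, `k` could be added to the center at level `c k - 1`, against
    -- maximality.
    suffices hX : IsCentral a (c k - 1) (insert k (centerSet a (c k - 1))) from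
      hk ((isGreatest_centerSet a (c k - 1)).2 hX (mem_insert_self _ _))
    intro x hx
    rw [mem_insert] at hx
    rcases hx with rfl | hx
    · have : #(insert x ({i | x < i ∧ c i < c x} : Finset (Fin n))) ≤
          #{y ∈ insert x (centerSet a (c x - 1)) | x ≤ y} := by
        refine card_le_card fun i hi => ?_
        simp only [mem_insert, mem_filter, mem_univ, true_and] at hi ⊢
        rcases hi with rfl | hi
        · exact ⟨Or.inl rfl, le_rfl⟩
        · exact ⟨Or.inr ((hc _ _).2 (by omega)), hi.1.le⟩
      rw [card_insert_of_notMem (by simp)] at this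
      omega
    · refine ((isGreatest_centerSet a (c k - 1)).1 x hx).trans (Nat.add_le_add_left ?_ _)
      exact card_le_card (filter_subset_filter _ (subset_insert _ _))
  have hup : ∀ k, a k ≤ c k + #{i ∈ univ | k < i ∧ c i ≤ c k} + 1 := by
    intro k
    have h1 := (isGreatest_centerSet a (c k)).1 k ((hc _ _).2 le_rfl)
    have h2 : #{y ∈ centerSet a (c k) | k ≤ y} ≤
        #(insert k ({i | k < i ∧ c i ≤ c k} : Finset (Fin n))) := by
      refine card_le_card fun i hi => ?_
      simp only [mem_insert, mem_filter, mem_univ, true_and, hc] at hi ⊢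
      rcases hi.2.eq_or_lt with h | h
      · exact Or.inl h.symm
      · exact Or.inr ⟨h, hi.1⟩
    rw [card_insert_of_notMem (by simp)] at h2
    omega
  obtain ⟨f, hinj, hmono, hcode⟩ := exists_injOn_code_eq c (fun k => a k - c k - 1) univ
    fun k _ => by
      have := hlow k
      have := hup k
      omega
  rw [coe_univ, Set.injOn_univ] at hinj
  have hmono : ∀ i j, c i < c j → f j < f i := fun i j => hmono i (mem_univ _) j (mem_univ _)
  obtain ⟨x, hx, hgen, hshift⟩ := exists_shift_eq m c hmono hinj univ fun k _ => by
    have hr : #{i | f k < f i} < n := by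
      have : #{i | f k < f i} < #(univ : Finset (Fin n)) :=
        card_lt_card ⟨subset_univ _, fun h => by simpa using h (mem_univ k)⟩
      simpa using this
    -- If `c k` exceeds `i * m`, with `i` the number of values above `f k`, the center at `i * m`
    -- contains only indices with values above `f k`, hence at most `i` of them.
    by_contra! hlt
    have h1 := ha.2 ⟨_, hr⟩
    have h2 : centerCard a (#{i | f k < f i} * m) ≤ #{i | f k < f i} := by
      refine card_le_card fun i hi => ?_
      rw [hc] at hi
      simpa using hmono i k (hi.trans_lt hlt)
    dsimp only at h1
    omega
  have hiff : ∀ i j, x i < x j ↔ f i < f j := by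
    intro i j
    refine ⟨fun h => ?_, hx i (mem_univ _) j (mem_univ _)⟩
    by_contra hle
    rcases (not_lt.1 hle).eq_or_lt with h' | h'
    · rw [hinj h'] at h
      exact h.false
    · exact (hx j (mem_univ _) i (mem_univ _) h').not_gt h
  refine ⟨x, fun i j => hgen i (mem_univ _) j (mem_univ _), funext fun k => ?_⟩
  have h1 : shiftCount m x k = c k := hshift k (mem_univ _)
  have h2 : codeCount x k = a k - c k - 1 := by
    rw [← hcode k (mem_univ k), codeCount]
    congr 1
    ext i
    simp [hiff]
  have := hlow k
  rw [pointLabel, h1, h2]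
  omega

end Realization

/-! ### Half-spaces of the arrangement. -/

namespace CatalanHyperplane

variable {m n : ℕ}

/-- The coordinate other than `bumpedCoord` in the equation of the hyperplane. -/
def otherCoord (H : CatalanHyperplane m n) : Fin n :=
  if 0 < H.a then H.i else H.j

instance : Finite (CatalanHyperplane m n) := by
  refine Finite.of_injective
    (fun H => ((H.i, H.j, ⟨H.a, H.neg_le, H.le⟩) : Fin n × Fin n × Set.Icc (-m : ℤ) m)) ?_
  intro H K h
  simp only [Prod.mk.injEq] at h
  exact CatalanHyperplane.ext h.1 h.2.1 (congrArg Subtype.val h.2.2)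

theorem isOpen_below (H : CatalanHyperplane m n) : IsOpen H.below :=
  isOpen_lt (by fun_prop) continuous_const

theorem isOpen_above (H : CatalanHyperplane m n) : IsOpen H.above :=
  isOpen_lt continuous_const (by fun_prop)

theorem isLinearMap_sub (i j : Fin n) : IsLinearMap ℝ fun x : Fin n → ℝ => x i - x j :=
  ⟨fun x y => by simp only [Pi.add_apply]; ring, fun c x => by
    simp only [Pi.smul_apply, smul_eq_mul]; ring⟩

theorem convex_below (H : CatalanHyperplane m n) : Convex ℝ H.below :=
  convex_halfSpace_lt (isLinearMap_sub _ _) _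

theorem convex_above (H : CatalanHyperplane m n) : Convex ℝ H.above :=
  convex_halfSpace_gt (isLinearMap_sub _ _) _

theorem disjoint_below_above (H : CatalanHyperplane m n) : Disjoint H.below H.above :=
  Set.disjoint_left.2 fun x (h1 : x H.i - x H.j < H.a) h2 => lt_asymm h1 h2

end CatalanHyperplane

/-! ### Regions as cells determined by their separating hyperplanes. -/

section Regions

open CatalanHyperplane

variable {m n : ℕ}

/-- The hyperplanes that separate `x` from the base region. -/
def farSide (m : ℕ) (x : Fin n → ℝ) : Set (CatalanHyperplane m n) :=
  {H | x H.bumpedCoord < x H.otherCoord - (H.a.natAbs : ℝ)}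

theorem mem_farSide_of_pos {H : CatalanHyperplane m n} (h : 0 < H.a) (x : Fin n → ℝ) :
    H ∈ farSide m x ↔ x ∈ H.above := by
  have : (H.a.natAbs : ℝ) = H.a := by
    rw [Nat.cast_natAbs, abs_of_pos h]
  simp only [farSide, bumpedCoord, otherCoord, if_pos h, Set.mem_ofPred_eq, above, this]
  exact lt_sub_comm

theorem mem_farSide_of_nonpos {H : CatalanHyperplane m n} (h : ¬ 0 < H.a) (x : Fin n → ℝ) :
    H ∈ farSide m x ↔ x ∈ H.below := by
  have : (H.a.natAbs : ℝ) = -H.a := by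
    rw [Nat.cast_natAbs, abs_of_nonpos (not_lt.1 h), Int.cast_neg]
  simp only [farSide, bumpedCoord, otherCoord, if_neg h, Set.mem_ofPred_eq, below, this]
  constructor <;> intro <;> linarith

theorem mem_catalanComplement {x : Fin n → ℝ} :
    x ∈ catalanComplement m n ↔ ∀ H : CatalanHyperplane m n, x H.i - x H.j ≠ H.a := by
  simp [catalanComplement, carrier]

theorem mem_below_or_mem_above {x : Fin n → ℝ} (hx : x ∈ catalanComplement m n)
    (H : CatalanHyperplane m n) : x ∈ H.below ∨ x ∈ H.above :=
  lt_or_gt_of_ne (mem_catalanComplement.1 hx H)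

theorem mem_below_iff_notMem_above {x : Fin n → ℝ} (hx : x ∈ catalanComplement m n)
    (H : CatalanHyperplane m n) : x ∈ H.below ↔ x ∉ H.above :=
  ⟨fun h => Set.disjoint_left.1 H.disjoint_below_above h,
    fun h => (mem_below_or_mem_above hx H).resolve_right h⟩

/-- Two points of the complement are on the same side of all hyperplanes that separate neither or
both of them from the base region. -/
theorem mem_above_iff_of_mem_farSide_iff {x y : Fin n → ℝ} (hx : x ∈ catalanComplement m n)
    (hy : y ∈ catalanComplement m n) {H : CatalanHyperplane m n} :
    (H ∈ farSide m x ↔ H ∈ farSide m y) ↔ (x ∈ H.above ↔ y ∈ H.above) := by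
  by_cases h : 0 < H.a
  · rw [mem_farSide_of_pos h, mem_farSide_of_pos h]
  · rw [mem_farSide_of_nonpos h, mem_farSide_of_nonpos h, mem_below_iff_notMem_above hx,
      mem_below_iff_notMem_above hy, not_iff_not]

/-- A connected subset of the complement cannot meet both sides of a hyperplane, and two points on
the same side of every hyperplane are joined by a segment in the complement. -/
theorem connectedComponentIn_catalanComplement {x : Fin n → ℝ}
    (hx : x ∈ catalanComplement m n) :
    connectedComponentIn (catalanComplement m n) x =
      {y | y ∈ catalanComplement m n ∧ farSide m y = farSide m x} := by
  have hsub := connectedComponentIn_subset (catalanComplement m n) x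
  have hself := mem_connectedComponentIn hx
  ext y
  constructor
  · intro hy
    refine ⟨hsub hy, Set.ext fun H => ?_⟩
    rw [mem_above_iff_of_mem_farSide_iff (hsub hy) hx]
    rcases isPreconnected_connectedComponentIn.subset_or_subset H.isOpen_below H.isOpen_above
      H.disjoint_below_above (fun z hz => mem_below_or_mem_above (hsub hz) H) with h | h
    · have h1 := (mem_below_iff_notMem_above hx H).1 (h hself)
      have h2 := (mem_below_iff_notMem_above (hsub hy) H).1 (h hy)
      exact iff_of_false h2 h1
    · exact iff_of_true (h hy) (h hself)
  · rintro ⟨hy, hxy⟩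
    refine (convex_segment x y).isPreconnected.subset_connectedComponentIn
      (left_mem_segment ℝ x y) ?_ (right_mem_segment ℝ x y)
    intro z hz
    rw [mem_catalanComplement]
    intro H
    have hside := (mem_above_iff_of_mem_farSide_iff hy hx).1 (Set.ext_iff.1 hxy H)
    by_cases h : x ∈ H.above
    · exact ne_of_gt (H.convex_above.segment_subset h (hside.2 h) hz)
    · exact ne_of_lt (H.convex_below.segment_subset ((mem_below_iff_notMem_above hx H).2 h)
        ((mem_below_iff_notMem_above hy H).2 fun h' => h (hside.1 h')) hz)

/-- The region that contains a given point of the complement. -/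
def regionOf {x : Fin n → ℝ} (hx : x ∈ catalanComplement m n) : catalanRegions m n :=
  ⟨connectedComponentIn (catalanComplement m n) x, x, hx, rfl⟩

theorem exists_regionOf_eq (R : catalanRegions m n) :
    ∃ x, ∃ hx : x ∈ catalanComplement m n, regionOf hx = R := by
  obtain ⟨R, x, hx, rfl⟩ := R
  exact ⟨x, hx, rfl⟩

theorem mem_regionOf {x y : Fin n → ℝ} (hx : x ∈ catalanComplement m n) :
    y ∈ (regionOf hx : Set (Fin n → ℝ)) ↔
      y ∈ catalanComplement m n ∧ farSide m y = farSide m x :=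
  Set.ext_iff.1 (connectedComponentIn_catalanComplement hx) y

theorem self_mem_regionOf {x : Fin n → ℝ} (hx : x ∈ catalanComplement m n) :
    x ∈ (regionOf hx : Set (Fin n → ℝ)) := mem_connectedComponentIn hx

theorem regionOf_eq_iff {x y : Fin n → ℝ} (hx : x ∈ catalanComplement m n)
    (hy : y ∈ catalanComplement m n) :
    regionOf hx = regionOf hy ↔ farSide m x = farSide m y := by
  constructor
  · intro h
    exact ((mem_regionOf hy).1 (h ▸ self_mem_regionOf hx)).2
  · intro h
    refine Subtype.ext (Set.ext fun z => ?_)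
    rw [mem_regionOf, mem_regionOf, h]

theorem regionOf_subset_above_iff {x : Fin n → ℝ} (hx : x ∈ catalanComplement m n)
    (H : CatalanHyperplane m n) : (regionOf hx : Set (Fin n → ℝ)) ⊆ H.above ↔ x ∈ H.above := by
  refine ⟨fun h => h (self_mem_regionOf hx), fun h y hy => ?_⟩
  obtain ⟨hy, hyx⟩ := (mem_regionOf hx).1 hy
  exact ((mem_above_iff_of_mem_farSide_iff hy hx).1 (Set.ext_iff.1 hyx H)).2 h

theorem regionOf_subset_below_iff {x : Fin n → ℝ} (hx : x ∈ catalanComplement m n)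
    (H : CatalanHyperplane m n) : (regionOf hx : Set (Fin n → ℝ)) ⊆ H.below ↔ x ∉ H.above := by
  rw [← mem_below_iff_notMem_above hx]
  refine ⟨fun h => h (self_mem_regionOf hx), fun h y hy => ?_⟩
  obtain ⟨hy, hyx⟩ := (mem_regionOf hx).1 hy
  rw [mem_below_iff_notMem_above hx] at h
  rw [mem_below_iff_notMem_above hy]
  exact fun h' => h (((mem_above_iff_of_mem_farSide_iff hy hx).1 (Set.ext_iff.1 hyx H)).1 h')

theorem separates_regionOf_iff {x y : Fin n → ℝ} (hx : x ∈ catalanComplement m n)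
    (hy : y ∈ catalanComplement m n) (H : CatalanHyperplane m n) :
    H.Separates (regionOf hx) (regionOf hy) ↔ ¬ (H ∈ farSide m x ↔ H ∈ farSide m y) := by
  rw [mem_above_iff_of_mem_farSide_iff hx hy]
  simp only [Separates, regionOf_subset_above_iff, regionOf_subset_below_iff]
  tauto

theorem sameSide_regionOf_iff {x y : Fin n → ℝ} (hx : x ∈ catalanComplement m n)
    (hy : y ∈ catalanComplement m n) (H : CatalanHyperplane m n) :
    H.SameSide (regionOf hx) (regionOf hy) ↔ (H ∈ farSide m x ↔ H ∈ farSide m y) := by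
  rw [mem_above_iff_of_mem_farSide_iff hx hy]
  simp only [SameSide, regionOf_subset_above_iff, regionOf_subset_below_iff]
  tauto

theorem mem_baseRegion_iff (hm : 0 < m) (x : Fin n → ℝ) :
    x ∈ baseRegion n ↔ x ∈ catalanComplement m n ∧ farSide m x = ∅ := by
  constructor
  · rintro ⟨hanti, hlt⟩
    have h : ∀ H : CatalanHyperplane m n, (0 < H.a → x ∈ H.below) ∧ (¬ 0 < H.a → x ∈ H.above) := by
      refine fun H => ⟨fun h => ?_, fun h => ?_⟩
      · have : (1 : ℝ) ≤ H.a := by exact_mod_cast h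
        exact (hlt _ _).trans_le this
      · have : (H.a : ℝ) ≤ 0 := by exact_mod_cast not_lt.1 h
        exact this.trans_lt (sub_pos.2 (hanti H.lt))
    refine ⟨mem_catalanComplement.2 fun H => ?_, Set.eq_empty_iff_forall_notMem.2 fun H => ?_⟩
    · by_cases ha : 0 < H.a
      · exact ne_of_lt ((h H).1 ha)
      · exact ne_of_gt ((h H).2 ha)
    · by_cases ha : 0 < H.a
      · rw [mem_farSide_of_pos ha]
        exact Set.disjoint_left.1 H.disjoint_below_above ((h H).1 ha)
      · rw [mem_farSide_of_nonpos ha]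
        exact Set.disjoint_right.1 H.disjoint_below_above ((h H).2 ha)
  · rintro ⟨hx, hfar⟩
    rw [Set.eq_empty_iff_forall_notMem] at hfar
    have hanti : StrictAnti x := by
      intro i j hij
      let H : CatalanHyperplane m n := ⟨i, j, 0, hij, by simp, by simp⟩
      have h1 := hfar H
      rw [mem_farSide_of_nonpos (by simp [H])] at h1
      have h2 : ((0 : ℤ) : ℝ) < x i - x j := (mem_below_or_mem_above hx H).resolve_left h1
      simpa using h2
    refine ⟨hanti, fun i j => ?_⟩
    rcases lt_or_ge i j with hij | hij
    · let H : CatalanHyperplane m n := ⟨i, j, 1, hij, by omega, by omega⟩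
      have h1 := hfar H
      rw [mem_farSide_of_pos (by simp [H])] at h1
      have h2 : x i - x j < ((1 : ℤ) : ℝ) := (mem_below_or_mem_above hx H).resolve_right h1
      simpa using h2
    · linarith [hanti.antitone hij]

theorem exists_regionOf_eq_baseRegion (hm : 0 < m) :
    ∃ b, ∃ hb : b ∈ catalanComplement m n,
      (regionOf hb : Set (Fin n → ℝ)) = baseRegion n ∧ farSide m b = ∅ := by
  have hmem : (fun i : Fin n => -((i : ℝ) / (n + 1))) ∈ baseRegion n := by
    have hn : (0 : ℝ) < n + 1 := by positivity
    refine ⟨fun i j hij => ?_, fun i j => ?_⟩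
    · have : (i : ℝ) < j := by exact_mod_cast hij
      exact neg_lt_neg (div_lt_div_of_pos_right this hn)
    · have h1 : (0 : ℝ) ≤ (i : ℝ) / (n + 1) := by positivity
      have h2 : ((j : ℕ) : ℝ) / (n + 1) < 1 := by
        rw [div_lt_one hn]
        exact_mod_cast j.2.trans (Nat.lt_succ_self n)
      linarith
  obtain ⟨hb, hfar⟩ := (mem_baseRegion_iff hm _).1 hmem
  refine ⟨_, hb, Set.ext fun z => ?_, hfar⟩
  rw [mem_regionOf, mem_baseRegion_iff hm, hfar]

theorem isOpen_catalanComplement : IsOpen (catalanComplement m n) := by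
  rw [catalanComplement, isOpen_compl_iff]
  exact isClosed_iUnion_of_finite fun H => isClosed_eq (by fun_prop) continuous_const

/-- The signed defect of the equation of `H` at `x`. -/
def CatalanHyperplane.defect (H : CatalanHyperplane m n) (x : Fin n → ℝ) : ℝ :=
  x H.i - x H.j - H.a

theorem defect_ne_zero {x : Fin n → ℝ} (hx : x ∈ catalanComplement m n)
    (H : CatalanHyperplane m n) : H.defect x ≠ 0 :=
  sub_ne_zero.2 (mem_catalanComplement.1 hx H)

theorem mem_above_iff_defect_pos {x : Fin n → ℝ} (H : CatalanHyperplane m n) :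
    x ∈ H.above ↔ 0 < H.defect x :=
  (sub_pos (a := x H.i - x H.j)).symm

/-- The inequality says that the segment from `z` to `y` does not meet `H` and `K` at the same
parameter. Equality on the whole open region would force proportional gradients, hence the same pair
of coordinates, then equal defects at `y`, and so `H = K`. -/
theorem exists_mem_regionOf_defect_mul_ne {x y : Fin n → ℝ} (hx : x ∈ catalanComplement m n)
    (hy : y ∈ catalanComplement m n) {H K : CatalanHyperplane m n} (hne : H ≠ K) :
    ∃ z ∈ (regionOf hx : Set (Fin n → ℝ)), H.defect z * K.defect y ≠ K.defect z * H.defect y := by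
  by_contra! hall
  have hopen : IsOpen (regionOf hx : Set (Fin n → ℝ)) :=
    isOpen_catalanComplement.connectedComponentIn
  let d : CatalanHyperplane m n → Fin n → ℝ := fun H k =>
    (if k = H.i then 1 else 0) - (if k = H.j then 1 else 0)
  have hcoef : ∀ k, d H k * K.defect y = d K k * H.defect y := by
    intro k
    have hcont : Continuous fun ε : ℝ => x + ε • (Pi.single k 1 : Fin n → ℝ) := by fun_prop
    have hev : ∀ᶠ ε in nhds (0 : ℝ), x + ε • (Pi.single k 1 : Fin n → ℝ) ∈
        (regionOf hx : Set (Fin n → ℝ)) :=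
      hcont.continuousAt.eventually_mem (hopen.mem_nhds (by simpa using self_mem_regionOf hx))
    obtain ⟨ε, hε, hpos⟩ := ((hev.filter_mono nhdsWithin_le_nhds).and
      (eventually_mem_nhdsWithin (a := (0 : ℝ)) (s := Set.Ioi 0))).exists
    have h1 := hall _ (self_mem_regionOf hx)
    have h2 := hall _ hε
    have hdef : ∀ L : CatalanHyperplane m n,
        L.defect (x + ε • (Pi.single k 1 : Fin n → ℝ)) = L.defect x + ε * d L k := by
      intro L
      simp only [defect, Pi.add_apply, Pi.smul_apply, Pi.single_apply, smul_eq_mul, d,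
        eq_comm (a := k)]
      ring
    rw [hdef, hdef] at h2
    exact mul_left_cancel₀ (ne_of_gt hpos) (by linarith)
  have hK := defect_ne_zero hy K
  have hi := hcoef H.i
  have hj := hcoef H.j
  have hH := H.lt
  have hKl := K.lt
  have hii : d H H.i = 1 := by simp [d, hH.ne]
  have hjj : d H H.j = -1 := by simp [d, hH.ne']
  have hi' : H.i = K.i ∨ H.i = K.j := by
    by_contra! h
    have : d K H.i = 0 := by simp [d, h]
    rw [hii, this] at hi
    exact hK (by linarith)
  have hj' : H.j = K.i ∨ H.j = K.j := by
    by_contra! h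
    have : d K H.j = 0 := by simp [d, h]
    rw [hjj, this] at hj
    exact hK (by linarith)
  have hieq : H.i = K.i := by grind
  have hjeq : H.j = K.j := by grind
  have hone : d K H.i = 1 := by
    rw [hieq]
    simp [d, hKl.ne]
  rw [hii, hone, defect, defect, hieq, hjeq] at hi
  refine hne (CatalanHyperplane.ext hieq hjeq ?_)
  have : (H.a : ℝ) = K.a := by linarith
  exact_mod_cast this

end Regions

/-! ### Existence, uniqueness and bijectivity of the labeling. -/

section Labeling

open CatalanHyperplane

variable {m n : ℕ}

/-- `p / (p - q)` is the parameter at which the affine function with end values `p` and `q`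
vanishes. -/
theorem convexComb_pos_iff {p q t : ℝ} (hp : p ≠ 0) (hq : q ≠ 0) (h : ¬ (0 < p ↔ 0 < q)) :
    (0 < p / (p - q) ∧ p / (p - q) < 1) ∧
    (p / (p - q) < t → (0 < (1 - t) * p + t * q ↔ 0 < q)) ∧
    (t < p / (p - q) → (0 < (1 - t) * p + t * q ↔ 0 < p)) := by
  rcases hp.lt_or_gt with hp | hp <;> rcases hq.lt_or_gt with hq | hq
  · exact absurd (iff_of_false hp.not_gt hq.not_gt) h
  · have hpq : p - q < 0 := by linarith
    refine ⟨⟨div_pos_of_neg_of_neg hp hpq, ?_⟩, fun ht => ?_, fun ht => ?_⟩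
    · rw [div_lt_one_of_neg hpq]
      linarith
    · rw [div_lt_iff_of_neg hpq] at ht
      exact iff_of_true (by linarith) hq
    · rw [lt_div_iff_of_neg hpq] at ht
      exact iff_of_false (by linarith) hp.not_gt
  · have hpq : 0 < p - q := by linarith
    refine ⟨⟨div_pos hp hpq, ?_⟩, fun ht => ?_, fun ht => ?_⟩
    · rw [div_lt_one hpq]
      linarith
    · rw [div_lt_iff₀ hpq] at ht
      exact iff_of_false (by linarith) hq.not_gt
    · rw [lt_div_iff₀ hpq] at ht
      exact iff_of_true (by linarith) hp
  · exact absurd (iff_of_true hp hq) h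

/-- Between two regions separated by two hyperplanes there is a third region. -/
theorem exists_farSide_ssubset_ssubset {x y : Fin n → ℝ} (hx : x ∈ catalanComplement m n)
    (hy : y ∈ catalanComplement m n) (hsub : farSide m x ⊆ farSide m y)
    {H K : CatalanHyperplane m n} (hne : H ≠ K) (hH : H ∈ farSide m y \ farSide m x)
    (hK : K ∈ farSide m y \ farSide m x) :
    ∃ z ∈ catalanComplement m n, farSide m x ⊂ farSide m z ∧ farSide m z ⊂ farSide m y := by
  obtain ⟨w, hwx, hdet⟩ := exists_mem_regionOf_defect_mul_ne hx hy hne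
  obtain ⟨hw, hfar⟩ := (mem_regionOf hx).1 hwx
  rw [← hfar] at hsub hH hK ⊢
  have hside : ∀ L : CatalanHyperplane m n, L ∈ farSide m y \ farSide m w →
      ¬ (0 < L.defect w ↔ 0 < L.defect y) := by
    intro L hL
    rw [← mem_above_iff_defect_pos, ← mem_above_iff_defect_pos,
      ← mem_above_iff_of_mem_farSide_iff hw hy]
    exact fun h => hL.2 (h.2 hL.1)
  wlog hlt : H.defect w / (H.defect w - H.defect y) < K.defect w / (K.defect w - K.defect y)
    generalizing H K with hwlog
  · refine hwlog hne.symm hH hK hdet.symm (lt_of_le_of_ne (not_lt.1 hlt) ?_)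
    have hsub_ne : ∀ L : CatalanHyperplane m n, L ∈ farSide m y \ farSide m w →
        L.defect w - L.defect y ≠ 0 := fun L hL h0 => hside L hL (by rw [sub_eq_zero.1 h0])
    rw [Ne, div_eq_div_iff (hsub_ne K hK) (hsub_ne H hH)]
    exact fun h => hdet (by linarith)
  let z : ℝ → Fin n → ℝ := fun t => (1 - t) • w + t • y
  have hz : ∀ (L : CatalanHyperplane m n) t,
      L.defect (z t) = (1 - t) * L.defect w + t * L.defect y := by
    intro L t
    simp only [defect, z, Pi.add_apply, Pi.smul_apply, smul_eq_mul]
    ring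
  have hfin : (⋃ L : CatalanHyperplane m n, {t | L.defect (z t) = 0}).Finite := by
    refine Set.finite_iUnion fun L => Set.Subsingleton.finite fun t ht s hs => ?_
    have ht : L.defect (z t) = 0 := ht
    have hs : L.defect (z s) = 0 := hs
    rw [hz] at ht hs
    have hmul : (t - s) * (L.defect y - L.defect w) = 0 := by linarith
    rcases mul_eq_zero.1 hmul with h | h
    · linarith
    · refine absurd ?_ (defect_ne_zero hw L)
      rw [sub_eq_zero.1 h] at ht
      linarith
  -- The point at `t` has crossed `H` but not yet `K`, and lies on no hyperplane.
  obtain ⟨t, ⟨ht1, ht2⟩, ht⟩ := ((Set.Ioo_infinite hlt).sdiff hfin).nonempty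
  have hzC : z t ∈ catalanComplement m n := by
    rw [mem_catalanComplement]
    intro L hL
    exact ht (Set.mem_iUnion.2 ⟨L, sub_eq_zero.2 hL⟩)
  have hH' := convexComb_pos_iff (t := t) (defect_ne_zero hw H) (defect_ne_zero hy H) (hside H hH)
  have hK' := convexComb_pos_iff (t := t) (defect_ne_zero hw K) (defect_ne_zero hy K) (hside K hK)
  have hHz : H ∈ farSide m (z t) := by
    refine ((mem_above_iff_of_mem_farSide_iff hzC hy).2 ?_).2 hH.1
    rw [mem_above_iff_defect_pos, mem_above_iff_defect_pos, hz]
    exact hH'.2.1 ht1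
  have hKz : K ∉ farSide m (z t) := by
    refine fun h => hK.2 (((mem_above_iff_of_mem_farSide_iff hzC hw).2 ?_).1 h)
    rw [mem_above_iff_defect_pos, mem_above_iff_defect_pos, hz]
    exact hK'.2.2 ht2
  have hseg : z t ∈ segment ℝ w y :=
    ⟨1 - t, t, by linarith [hK'.1.2], by linarith [hH'.1.1], by ring, rfl⟩
  have hsame : ∀ L : CatalanHyperplane m n, (L ∈ farSide m w ↔ L ∈ farSide m y) →
      (L ∈ farSide m (z t) ↔ L ∈ farSide m w) := by
    intro L hL
    rw [mem_above_iff_of_mem_farSide_iff hw hy] at hL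
    rw [mem_above_iff_of_mem_farSide_iff hzC hw]
    by_cases h : w ∈ L.above
    · exact iff_of_true (L.convex_above.segment_subset h (hL.1 h) hseg) h
    · refine iff_of_false ((mem_below_iff_notMem_above hzC L).1 ?_) h
      exact L.convex_below.segment_subset ((mem_below_iff_notMem_above hw L).2 h)
        ((mem_below_iff_notMem_above hy L).2 fun h' => h (hL.2 h')) hseg
  refine ⟨z t, hzC, ⟨fun L hL => ?_, fun h => hH.2 (h hHz)⟩,
    ⟨fun L hL => ?_, fun h => hKz (h hK.1)⟩⟩
  · exact (hsame L (iff_of_true hL (hsub hL))).2 hL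
  · by_contra hLy
    exact hLy (hsub ((hsame L (iff_of_false (fun h => hLy (hsub h)) hLy)).1 hL))

theorem IsPakStanleyLabeling.eq_of_farSide_subset (hm : 0 < m)
    {lab lab' : catalanRegions m n → Fin n → ℕ} (h : IsPakStanleyLabeling m n lab)
    (h' : IsPakStanleyLabeling m n lab') {x y : Fin n → ℝ} (hx : x ∈ catalanComplement m n)
    (hy : y ∈ catalanComplement m n) (hsub : farSide m x ⊆ farSide m y)
    (heq : lab (regionOf hx) = lab' (regionOf hx)) :
    lab (regionOf hy) = lab' (regionOf hy) := by
  induction hN : (farSide m y \ farSide m x).ncard using Nat.strong_induction_on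
    generalizing x y with
  | _ N ih =>
    -- Two separating hyperplanes allow a stop at an intermediate region; a single one is the
    -- situation of rule (ii).
    by_cases htwo : ∃ H ∈ farSide m y \ farSide m x, ∃ K ∈ farSide m y \ farSide m x, H ≠ K
    · obtain ⟨H, hH, K, hK, hne⟩ := htwo
      obtain ⟨z, hz, ⟨hxz, hzx⟩, ⟨hzy, hyz⟩⟩ :=
        exists_farSide_ssubset_ssubset hx hy hsub hne hH hK
      obtain ⟨L, hLz, hLx⟩ := Set.not_subset.1 hzx
      obtain ⟨L', hLy', hLz'⟩ := Set.not_subset.1 hyz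
      refine ih _ ?_ hz hy hzy (ih _ ?_ hx hz hxz heq rfl) rfl
      · rw [← hN]
        exact Set.ncard_lt_ncard ⟨Set.sdiff_subset_sdiff_right hxz,
          fun h => (h ⟨hzy hLz, hLx⟩).2 hLz⟩ (Set.toFinite _)
      · rw [← hN]
        exact Set.ncard_lt_ncard ⟨Set.sdiff_subset_sdiff_left hzy,
          fun h => hLz' (h ⟨hLy', fun h => hLz' (hxz h)⟩).1⟩ (Set.toFinite _)
    · push Not at htwo
      rcases (farSide m y \ farSide m x).eq_empty_or_nonempty with he | ⟨H, hH⟩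
      · have : regionOf hx = regionOf hy :=
          (regionOf_eq_iff hx hy).2 (hsub.antisymm (Set.sdiff_eq_empty.1 he))
        rwa [← this]
      · obtain ⟨b, hb, hbase, hbfar⟩ := exists_regionOf_eq_baseRegion (n := n) hm
        have hsep : H.Separates (regionOf hx) (regionOf hy) :=
          (separates_regionOf_iff hx hy H).2 fun h => hH.2 (h.2 hH.1)
        have huniq : ∀ K : CatalanHyperplane m n,
            K.Separates (regionOf hx) (regionOf hy) → K = H := by
          intro K hK
          rw [separates_regionOf_iff] at hK
          refine htwo K ?_ H hH
          by_cases hKx : K ∈ farSide m x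
          · exact absurd (iff_of_true hKx (hsub hKx)) hK
          · exact ⟨by tauto, hKx⟩
        have hsame : H.SameSide (baseRegion n) (regionOf hx) := by
          rw [← hbase, sameSide_regionOf_iff, hbfar]
          exact iff_of_false (Set.notMem_empty H) hH.2
        rw [h.step _ _ H hsep huniq hsame, h'.step _ _ H hsep huniq hsame, heq]

theorem IsPakStanleyLabeling.unique (hm : 0 < m) {lab lab' : catalanRegions m n → Fin n → ℕ}
    (h : IsPakStanleyLabeling m n lab) (h' : IsPakStanleyLabeling m n lab') : lab = lab' := by
  funext R
  obtain ⟨x, hx, rfl⟩ := exists_regionOf_eq R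
  obtain ⟨b, hb, hbase, hbfar⟩ := exists_regionOf_eq_baseRegion (n := n) hm
  refine h.eq_of_farSide_subset hm h' hb hx ?_ ?_
  · rw [hbfar]
    exact Set.empty_subset _
  · rw [h.base _ hbase, h'.base _ hbase]

/-- Since `i < j`, the order of the two coordinates tells whether `a` is positive. -/
theorem CatalanHyperplane.eq_of_coords {H K : CatalanHyperplane m n}
    (h1 : H.bumpedCoord = K.bumpedCoord) (h2 : H.otherCoord = K.otherCoord)
    (h3 : H.a.natAbs = K.a.natAbs) : H = K := by
  have hH := H.lt
  have hK := K.lt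
  unfold bumpedCoord at h1
  unfold otherCoord at h2
  split_ifs at h1 h2 with ha hb hb
  · exact CatalanHyperplane.ext h2 h1 (by omega)
  · rw [h1, h2] at hH
    exact absurd hH hK.not_gt
  · rw [h1, h2] at hH
    exact absurd hH hK.not_gt
  · exact CatalanHyperplane.ext h1 h2 (by omega)

/-- The label counts the separating hyperplanes by their bumped coordinates. -/
theorem pointLabel_eq_ncard (x : Fin n → ℝ) (k : Fin n) :
    pointLabel m x k = {H ∈ farSide m x | H.bumpedCoord = k}.ncard + 1 := by
  classical
  let S : Finset (Fin n × ℕ) :=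
    {p ∈ (univ : Finset (Fin n)) ×ˢ Icc 1 m | x k < x p.1 - (p.2 : ℝ)}
  -- Code entries become pairs with shift `0`, so that a hyperplane corresponds to the pair (other
  -- coordinate, `|a|`).
  let T : Finset (Fin n × ℕ) := ({i ∈ Ioi k | x k < x i}).image fun i => (i, 0)
  have hdisj : Disjoint S T := by
    rw [Finset.disjoint_left]
    rintro ⟨i, t⟩ h1 h2
    simp only [S, T, mem_filter, mem_product, mem_Icc, mem_image, Prod.mk.injEq] at h1 h2
    obtain ⟨_, _, _, rfl⟩ := h2
    omega
  have hcard : pointLabel m x k = #(S ∪ T) + 1 := by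
    rw [card_union_of_disjoint hdisj, card_image_of_injective _ fun i j h => congrArg Prod.fst h]
    rfl
  have hmem : ∀ i (t : ℕ), (i, t) ∈ S ∪ T ↔ t ≤ m ∧ (t = 0 → k < i) ∧ x k < x i - t := by
    intro i t
    rcases Nat.eq_zero_or_pos t with rfl | ht
    · simp [S, T]
    · simp [S, T, ht.ne, ht.ne', Nat.succ_le_iff, ht]
  rw [hcard, ← Set.ncard_coe_finset]
  congr 1
  symm
  refine Set.ncard_congr (fun H _ => (H.otherCoord, H.a.natAbs)) ?_ ?_ ?_
  · rintro H ⟨hH, hk⟩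
    have hH : x H.bumpedCoord < x H.otherCoord - (H.a.natAbs : ℝ) := hH
    rw [hk] at hH
    rw [mem_coe, hmem]
    have h1 := H.le
    have h2 := H.neg_le
    refine ⟨by omega, fun h0 => ?_, hH⟩
    have : ¬ 0 < H.a := by omega
    rw [bumpedCoord, if_neg this] at hk
    rw [otherCoord, if_neg this, ← hk]
    exact H.lt
  · rintro H K ⟨_, hk⟩ ⟨_, hk'⟩ h
    exact CatalanHyperplane.eq_of_coords (hk.trans hk'.symm) (congrArg Prod.fst h)
      (congrArg Prod.snd h)
  · rintro ⟨i, t⟩ h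
    rw [mem_coe, hmem] at h
    obtain ⟨htm, h0, hlt⟩ := h
    have hne : i ≠ k := by
      rintro rfl
      linarith [(Nat.cast_nonneg t : (0 : ℝ) ≤ t)]
    rcases hne.lt_or_gt with hik | hki
    · have ht : 0 < (t : ℤ) := by
        by_contra h
        exact (h0 (by omega)).not_gt hik
      refine ⟨⟨i, k, t, hik, by omega, by omega⟩, ⟨?_, ?_⟩, ?_⟩
      · simpa [farSide, bumpedCoord, otherCoord, Int.natCast_pos.1 ht] using hlt
      · exact if_pos ht
      · simp [otherCoord, Int.natCast_pos.1 ht]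
    · have ht : ¬ 0 < (-t : ℤ) := by omega
      refine ⟨⟨k, i, -t, hki, by omega, by omega⟩, ⟨?_, ?_⟩, ?_⟩
      · change x (if 0 < (-t : ℤ) then i else k) <
          x (if 0 < (-t : ℤ) then k else i) - ((-t : ℤ).natAbs : ℝ)
        rwa [if_neg ht, if_neg ht, Int.natAbs_neg, Int.natAbs_natCast]
      · exact if_neg ht
      · simp [otherCoord]

theorem pointLabel_eq_of_farSide_eq {x y : Fin n → ℝ} (h : farSide m x = farSide m y) :
    pointLabel m x = pointLabel m y := by
  funext k
  rw [pointLabel_eq_ncard, pointLabel_eq_ncard, h]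

theorem injective_of_mem_catalanComplement {x : Fin n → ℝ} (hx : x ∈ catalanComplement m n) :
    x.Injective := by
  have key : ∀ i j, i < j → x i ≠ x j := by
    intro i j hij h
    refine mem_catalanComplement.1 hx ⟨i, j, 0, hij, by simp, by simp⟩ ?_
    simp [h]
  intro i j h
  rcases lt_trichotomy i j with hij | hij | hij
  · exact absurd h (key i j hij)
  · exact hij
  · exact absurd h.symm (key j i hij)

/-- The label of a region. -/
noncomputable def regionLabel (R : catalanRegions m n) : Fin n → ℕ :=
  pointLabel m (exists_regionOf_eq R).choose

theorem regionLabel_regionOf {x : Fin n → ℝ} (hx : x ∈ catalanComplement m n) :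
    regionLabel (regionOf hx) = pointLabel m x :=
  have h := (exists_regionOf_eq (regionOf hx)).choose_spec
  pointLabel_eq_of_farSide_eq ((regionOf_eq_iff h.choose hx).1 h.choose_spec)

theorem isPakStanleyLabeling_regionLabel (hm : 0 < m) :
    IsPakStanleyLabeling m n regionLabel := by
  obtain ⟨b, hb, hbase, hbfar⟩ := exists_regionOf_eq_baseRegion (n := n) hm
  constructor
  · intro R hR
    obtain rfl : regionOf hb = R := Subtype.ext (hbase.trans hR.symm)
    funext k
    rw [regionLabel_regionOf, pointLabel_eq_ncard, hbfar]
    simp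
  · intro R₁ R₂ H hsep huniq hsame
    obtain ⟨x, hx, rfl⟩ := exists_regionOf_eq R₁
    obtain ⟨y, hy, rfl⟩ := exists_regionOf_eq R₂
    rw [← hbase, sameSide_regionOf_iff, hbfar] at hsame
    have hHx : H ∉ farSide m x := fun h => Set.notMem_empty H (hsame.2 h)
    rw [separates_regionOf_iff] at hsep
    -- Crossing `H` adds `H` alone to the far side, so only the count at its bumped coordinate
    -- grows.
    have hfar : farSide m y = insert H (farSide m x) := by
      ext K
      rw [Set.mem_insert_iff]
      have := huniq K
      rw [separates_regionOf_iff] at this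
      by_cases hK : K = H
      · subst hK
        tauto
      · tauto
    funext k
    rw [Pi.add_apply, regionLabel_regionOf, regionLabel_regionOf, pointLabel_eq_ncard,
      pointLabel_eq_ncard, hfar, Pi.single_apply]
    by_cases hk : k = H.bumpedCoord
    · have : {K ∈ insert H (farSide m x) | K.bumpedCoord = k} =
          insert H {K ∈ farSide m x | K.bumpedCoord = k} := by
        ext K
        simp only [Set.mem_insert_iff, Set.mem_ofPred_eq]
        constructor
        · tauto
        · rintro (rfl | h)
          · exact ⟨Or.inl rfl, hk.symm⟩
          · exact ⟨Or.inr h.1, h.2⟩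
      rw [this, Set.ncard_insert_of_notMem (fun h => hHx h.1) (Set.toFinite _), if_pos hk]
    · have : {K ∈ insert H (farSide m x) | K.bumpedCoord = k} =
          {K ∈ farSide m x | K.bumpedCoord = k} := by
        ext K
        simp only [Set.mem_insert_iff, Set.mem_ofPred_eq]
        constructor
        · rintro ⟨rfl | h, h'⟩
          · exact absurd h'.symm hk
          · exact ⟨h, h'⟩
        · tauto
      rw [this, if_neg hk, add_zero]

theorem regionLabel_injective : Function.Injective (regionLabel (m := m) (n := n)) := by
  intro R S h
  obtain ⟨x, hx, rfl⟩ := exists_regionOf_eq R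
  obtain ⟨y, hy, rfl⟩ := exists_regionOf_eq S
  rw [regionLabel_regionOf, regionLabel_regionOf] at h
  rw [regionOf_eq_iff]
  ext H
  have h1 := H.le
  have h2 := H.neg_le
  -- Membership in `farSide` is by definition a comparison with the shift `|a| ≤ m`.
  exact lt_sub_iff_of_pointLabel_eq (injective_of_mem_catalanComplement hx)
    (injective_of_mem_catalanComplement hy) h _ _ (by omega)

theorem range_regionLabel :
    Set.range (regionLabel (m := m) (n := n)) = catalanFunctions m n := by
  ext a
  constructor
  · rintro ⟨R, rfl⟩
    exact pointLabel_mem_catalanFunctions _ _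
  · intro ha
    obtain ⟨x, hx, rfl⟩ := exists_pointLabel_eq ha
    have hxC : x ∈ catalanComplement m n := by
      rw [mem_catalanComplement]
      intro H h
      exact hx H.i H.j H.lt.ne H.a (mem_Icc.2 ⟨H.neg_le, H.le⟩) (by linarith)
    exact ⟨regionOf hxC, regionLabel_regionOf hxC⟩

end Labeling

theorem mainTheorem1 (m n : ℕ) (hm : 0 < m) (hn : 0 < n) :
    (∃! lab : catalanRegions m n → (Fin n → ℕ), IsPakStanleyLabeling m n lab) ∧
    ∀ lab : catalanRegions m n → (Fin n → ℕ), IsPakStanleyLabeling m n lab →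
      Set.range lab = catalanFunctions m n ∧
      Set.BijOn lab Set.univ (catalanFunctions m n) := by
  have hlab := isPakStanleyLabeling_regionLabel (n := n) hm
  refine ⟨⟨regionLabel, hlab, fun lab h => h.unique hm hlab⟩, fun lab h => ?_⟩
  obtain rfl := h.unique hm hlab
  refine ⟨range_regionLabel, Set.mapsTo_univ_iff.2 fun R => ?_, regionLabel_injective.injOn, ?_⟩
  · rw [← range_regionLabel]
    exact Set.mem_range_self R
  · rw [Set.SurjOn, Set.image_univ, range_regionLabel]
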